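/- Let $d\ge 1$, $u>0$, and let $V\in C^2(\mathbb R^d)$ be of the form $V(x)=\tfrac12\,x\cdot Kx+G(x)$, where $K\in\mathbb R^{d\times d}$ is symmetric positive definite with smallest eigenvalue $\kappa$ and largest eigenvalue $L_K$, and $G:\mathbb R^d\to\mathbb R$ is convex with $|\nabla G(x)-\nabla G(\bar x)|\le L_G|x-\bar x|$ for all $x,\bar x$. For $\gamma>0$ consider the Langevin dynamics $$\mathrm dX_t=Y_t\,\mathrm dt,\qquad \mathrm dY_t=(-\gamma Y_t-u\nabla V(X_t))\,\mathrm dt+\sqrt{2\gamma u}\,\mathrm dB_t,$$ where $B$ is a $d$-dimensional standard Brownian motion independent of $(X_0,Y_0)$. For $p\ge1$ and a distance function $\delta$ on $\mathbb R^{2d}$ let $$\mathcal W_{p,\delta}(\mu,\nu)=\inf_{\omega}\Big(\int \delta(z,z')^p\,\omega(\mathrm dz\,\mathrm dz')\Big)^{1/p}\in[0,\infty],$$ the infimum being over all couplings $\omega$ of the probability measures $\mu,\nu$ on $\mathbb R^{2d}$, and let $\mathcal W_p$ be the case of the Euclidean distance. Put $$\lambda=\min\big(\tfrac18,\tfrac12\kappa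 u\gamma^{-2}\big),\qquad c=\gamma\lambda=\min\big(\tfrac{\gamma}{8},\tfrac12\kappa u\gamma^{-1}\big),\qquad M=\sqrt{\max(uL_K+\gamma^2,\tfrac32)\,\max(\tfrac1{u\kappa},2)},$$ $$r((x,y),(\bar x,\bar y))^2=\gamma^{-2}u\,(x-\bar x)\cdot K(x-\bar x)+\tfrac12\big|(1-2\lambda)(x-\bar x)+\gamma^{-1}(y-\bar y)\big|^2+\tfrac12\gamma^{-2}|y-\bar y|^2,\qquad r\ge0.$$ (i) Suppose $L_Gu\gamma^{-2}\le\tfrac34$. Let $(X_t,Y_t)_{t\ge0}$ and $(X'_t,Y'_t)_{t\ge0}$ be solutions of the Langevin dynamics (possibly on different probability spaces) with arbitrary initial distributions $\mu_0,\nu_0$ on $\mathbb R^{2d}$, and let $\mu_t,\nu_t$ be their laws at time $t$. Then for all $1\le p<\infty$ and $t\ge0$, $$\mathcal W_{p,r}(\mu_t,\nu_t)\le e^{-ct}\,\mathcal W_{p,r}(\mu_0,\nu_0)\qquad\text{and}\qquad \mathcal W_p(\mu_t,\nu_t)\le M e^{-ct}\,\mathcal W_p(\mu_0,\nu_0).$$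 (ii) If $L_G\le 3\kappa$, then $\gamma=2\sqrt{\kappa u}$ satisfies $L_Gu\gamma^{-2}\le\tfrac34$, and for this $\gamma$ the rate is $c=\sqrt{\kappa u}/4$, which is of order $\sqrt\kappa$. -/

import Mathlib

open MeasureTheory ProbabilityTheory
open scoped NNReal ENNReal

noncomputable section

namespace Langevin

/-- Position or velocity space: `ℝ^d` with the Euclidean norm. -/
abbrev Space (d : ℕ) := EuclideanSpace ℝ (Fin d)

/-- Phase space `ℝ^d × ℝ^d` of pairs (position, velocity), with its Borel σ-algebra. It is used only
as a measurable space; distances on it are always given explicitly. -/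
abbrev Phase (d : ℕ) := Space d × Space d

/-- A `d`-dimensional standard Brownian motion: the coordinates are independent real Brownian
motions. -/
structure IsBrownianMotion {d : ℕ} {Ω : Type*} [MeasurableSpace Ω] (P : Measure Ω)
    (B : ℝ≥0 → Ω → Space d) : Prop where
  measurable : ∀ t, Measurable (B t)
  isBrownianReal : ∀ i, IsBrownianReal (fun t ω ↦ B t ω i) P
  indep : iIndepFun (fun i ω (t : ℝ≥0) ↦ B t ω i) P

/-- `(X, Y)` solves `dX = Y dt`, `dY = (-γ Y - u ∇V(X)) dt + √(2γu) dB` on the probability space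
`(Ω, P)`, for a standard Brownian motion `B` that is independent of the initial value `(X₀, Y₀)`.
The noise being additive, the equation is the pathwise integral equation (and, for Lipschitz `∇V`,
adaptedness of `(X, Y)` to the filtration generated by `(X₀, Y₀)` and `B` is automatic). -/
structure IsSolution {d : ℕ} {Ω : Type*} [MeasurableSpace Ω] (P : Measure Ω)
    (V : Space d → ℝ) (u γ : ℝ) (B X Y : ℝ≥0 → Ω → Space d) : Prop where
  brownian : IsBrownianMotion P B
  measurable_pos : ∀ t, Measurable (X t)
  measurable_vel : ∀ t, Measurable (Y t)
  indep_init : IndepFun (fun ω ↦ (X 0 ω, Y 0 ω)) (fun ω (t : ℝ≥0) ↦ B t ω) P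
  continuous_paths : ∀ᵐ ω ∂P, Continuous (fun t ↦ X t ω) ∧ Continuous (fun t ↦ Y t ω)
  pos_eq : ∀ᵐ ω ∂P, ∀ t : ℝ≥0, X t ω = X 0 ω + ∫ s in (0 : ℝ)..t, Y s.toNNReal ω
  vel_eq : ∀ᵐ ω ∂P, ∀ t : ℝ≥0, Y t ω = Y 0 ω
    + (∫ s in (0 : ℝ)..t, (-(γ • Y s.toNNReal ω) - u • gradient V (X s.toNNReal ω)))
    + √(2 * γ * u) • B t ω

/-- The law of `(X_t, Y_t)` on phase space. -/
def lawAt {d : ℕ} {Ω : Type*} [MeasurableSpace Ω] (P : Measure Ω)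
    (X Y : ℝ≥0 → Ω → Space d) (t : ℝ≥0) : Measure (Phase d) :=
  P.map (fun ω ↦ (X t ω, Y t ω))

/-- The couplings of `μ` and `ν`. -/
def couplings {S : Type*} [MeasurableSpace S] (μ ν : Measure S) : Set (Measure (S × S)) :=
  {ω | IsProbabilityMeasure ω ∧ ω.map Prod.fst = μ ∧ ω.map Prod.snd = ν}

/-- The `L^p` Wasserstein distance with respect to the distance function `dist`, with values in
`[0, ∞]`. -/
def wasserstein {S : Type*} [MeasurableSpace S] (p : ℝ) (dist : S → S → ℝ) (μ ν : Measure S) :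
    ℝ≥0∞ :=
  ⨅ ω ∈ couplings μ ν, (∫⁻ z, ENNReal.ofReal (dist z.1 z.2) ^ p ∂ω) ^ (1 / p)

/-- The Euclidean distance on phase space, `√(|x - x'|² + |y - y'|²)`. -/
def euclDist {d : ℕ} (z w : Phase d) : ℝ :=
  √(‖z.1 - w.1‖ ^ 2 + ‖z.2 - w.2‖ ^ 2)

/-- The twist parameter `λ = min(1/8, κ u γ⁻² / 2)`. -/
def twist (κ u γ : ℝ) : ℝ := min (1 / 8) (κ * u * γ⁻¹ ^ 2 / 2)

/-- The twisted quadratic distance: the square root of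
`γ⁻² u (x-x')·K(x-x') + |(1-2λ)(x-x') + γ⁻¹(y-y')|² / 2 + γ⁻² |y-y'|² / 2`. -/
def twistedDist {d : ℕ} (K : Matrix (Fin d) (Fin d) ℝ) (κ u γ : ℝ) (z w : Phase d) : ℝ :=
  √(γ⁻¹ ^ 2 * u * inner ℝ (z.1 - w.1) (Matrix.toEuclideanLin K (z.1 - w.1))
    + 1 / 2 * ‖(1 - 2 * twist κ u γ) • (z.1 - w.1) + γ⁻¹ • (z.2 - w.2)‖ ^ 2
    + 1 / 2 * γ⁻¹ ^ 2 * ‖z.2 - w.2‖ ^ 2)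

/-- The contraction rate `c = min(γ/8, κ u γ⁻¹ / 2)`. -/
def rate (κ u γ : ℝ) : ℝ := min (γ / 8) (κ * u * γ⁻¹ / 2)

/-- The constant `M = √(max(u L_K + γ², 3/2) max(1/(u κ), 2))`. -/
def equivConst (κ L_K u γ : ℝ) : ℝ :=
  √(max (u * L_K + γ ^ 2) (3 / 2) * max (1 / (u * κ)) 2)

end Langevin

end

/-! The argument is a synchronous coupling: with the same noise in both copies, the difference of
two solutions obeys a noise-free equation whose drift contracts the twisted quadratic form. For a
difference `(z, w)` and `g` the difference of the gradients of `G`, the form is chosen so that the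
mixed terms `z·Kw` cancel. After the terms matching the rate are removed, a multiple of `|w +
uγ⁻¹g|²` remains, plus a `|g|²` term that cocoercivity, `|g|² ≤ L_G z·g`, lets the restoring term
absorb. This infinitesimal estimate is `twistedBilin_le`.

The two solutions may live on different probability spaces, so they cannot be coupled directly.
Instead, `X_t, Y_t` is realised as an almost sure limit of Euler schemes, which are explicit
measurable functions of the initial value and the Brownian path
(`exists_measurable_limit_langevinEuler`). One step of size `h` contracts by `exp(-ch + Ch²)`, so
`n` steps of size `t/n` contract by `exp(-ct + Ct²/n)`. Feeding any coupling of the initial laws and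
one independent Brownian path into both limits gives a coupling at time `t` with the bound `e^{-ct}`
(`wasserstein_le_of_tendsto`). The factor `M` is the cost of comparing the twisted with the
Euclidean distance. -/

namespace Langevin

/-! ### Convex functions with Lipschitz gradient -/

section Cocoercivity

variable {H : Type*} [NormedAddCommGroup H] [InnerProductSpace ℝ H] [CompleteSpace H]
  {G : H → ℝ} {L : ℝ}

lemma hasDerivAt_comp_line (hG : Differentiable ℝ G) (x v : H) (s : ℝ) :
    HasDerivAt (fun s : ℝ ↦ G (x + s • v)) (inner ℝ (gradient G (x + s • v)) v) s := by
  have h1 : HasDerivAt (fun s : ℝ ↦ x + s • v) v s := by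
    simpa using ((hasDerivAt_id s).smul_const v).const_add x
  have h2 := (hG (x + s • v)).hasFDerivAt.comp_hasDerivAt s h1
  rw [inner_gradient_left]
  exact h2

/-- The descent lemma for functions with Lipschitz gradient. -/
lemma le_add_of_lipschitz_gradient (hG : Differentiable ℝ G)
    (hL : ∀ x y, ‖gradient G x - gradient G y‖ ≤ L * ‖x - y‖) (x v : H) :
    G (x + v) ≤ G x + inner ℝ (gradient G x) v + L / 2 * ‖v‖ ^ 2 := by
  let f : ℝ → ℝ := fun s ↦ G (x + s • v) - s * inner ℝ (gradient G x) v - L / 2 * ‖v‖ ^ 2 * s ^ 2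
  have hf : ∀ s, HasDerivAt f (inner ℝ (gradient G (x + s • v)) v - inner ℝ (gradient G x) v
      - L * ‖v‖ ^ 2 * s) s := by
    intro s
    have h := (((hasDerivAt_comp_line hG x v s).sub
      ((hasDerivAt_id s).mul_const (inner ℝ (gradient G x) v))).sub
      ((hasDerivAt_pow 2 s).const_mul (L / 2 * ‖v‖ ^ 2)))
    refine h.congr_deriv ?_
    simp
    ring
  have hanti : AntitoneOn f (Set.Icc 0 1) := by
    refine antitoneOn_of_deriv_nonpos (convex_Icc 0 1)
      (fun s _ ↦ (hf s).continuousAt.continuousWithinAt)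
      (fun s _ ↦ (hf s).differentiableAt.differentiableWithinAt) ?_
    intro s hs
    rw [interior_Icc] at hs
    rw [(hf s).deriv, ← inner_sub_left]
    have h1 := real_inner_le_norm (gradient G (x + s • v) - gradient G x) v
    have h2 := hL (x + s • v) x
    rw [add_sub_cancel_left, norm_smul, Real.norm_of_nonneg hs.1.le] at h2
    nlinarith [mul_le_mul_of_nonneg_right h2 (norm_nonneg v)]
  have h := hanti (Set.left_mem_Icc.2 zero_le_one) (Set.right_mem_Icc.2 zero_le_one) zero_le_one
  simp only [f, one_smul, zero_smul, add_zero] at h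
  linarith

/-- The gradient inequality for convex functions. -/
lemma add_inner_gradient_le (hG : Differentiable ℝ G) (hc : ConvexOn ℝ Set.univ G) (x y : H) :
    G x + inner ℝ (gradient G x) (y - x) ≤ G y := by
  have hconv : ConvexOn ℝ Set.univ (fun s : ℝ ↦ G (x + s • (y - x))) := by
    refine ⟨convex_univ, fun a _ b _ α β hα hβ hαβ ↦ ?_⟩
    have h := hc.2 (Set.mem_univ (x + a • (y - x))) (Set.mem_univ (x + b • (y - x))) hα hβ hαβ
    have hx : α • (x + a • (y - x)) + β • (x + b • (y - x))
        = x + (α • a + β • b) • (y - x) := by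
      have : x = (α + β) • x := by rw [hαβ, one_smul]
      -- Only the base point on the right-hand side is split.
      nth_rw 5 [this]
      simp only [smul_eq_mul]
      module
    rw [hx] at h
    exact h
  have hd := hasDerivAt_comp_line hG x (y - x) 0
  have h := hconv.le_slope_of_hasDerivAt (Set.mem_univ 0) (Set.mem_univ 1) zero_lt_one hd
  simp only [slope_def_field, zero_smul, add_zero, one_smul, add_sub_cancel, sub_zero,
    div_one] at h
  linarith

/-- The gradient of a convex function with Lipschitz gradient is cocoercive (Baillon–Haddad). -/
lemma cocoercive_gradient (hG : Differentiable ℝ G) (hc : ConvexOn ℝ Set.univ G)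
    (hL : ∀ x y, ‖gradient G x - gradient G y‖ ≤ L * ‖x - y‖) (x y : H) :
    0 ≤ inner ℝ (x - y) (gradient G x - gradient G y) ∧
    ‖gradient G x - gradient G y‖ ^ 2 ≤ L * inner ℝ (x - y) (gradient G x - gradient G y) := by
  rcases le_or_gt L 0 with hL0 | hL0
  · have h : gradient G x - gradient G y = 0 := norm_le_zero_iff.1
      ((hL x y).trans (mul_nonpos_of_nonpos_of_nonneg hL0 (norm_nonneg _)))
    simp [h]
  have key : ∀ x y : H, G y + inner ℝ (gradient G y) (x - y)
      + ‖gradient G x - gradient G y‖ ^ 2 / (2 * L) ≤ G x := by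
    intro x y
    set w := gradient G x - gradient G y with hw
    -- `G` is evaluated at the gradient step `x - L⁻¹w`: the descent lemma at `x` bounds it above,
    -- the tangent at `y` bounds it below. Adding `key` with `x` and `y` exchanged then eliminates
    -- the values of `G`.
    have h1 := le_add_of_lipschitz_gradient hG hL x (-(L⁻¹ • w))
    have h2 := add_inner_gradient_le hG hc y (x + -(L⁻¹ • w))
    have h3 : inner ℝ (gradient G y) (x + -(L⁻¹ • w) - y)
        = inner ℝ (gradient G y) (x - y) - L⁻¹ * inner ℝ (gradient G y) w := by
      rw [show x + -(L⁻¹ • w) - y = (x - y) - L⁻¹ • w by abel, inner_sub_right, inner_smul_right]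
    have h4 : inner ℝ (gradient G x) w = inner ℝ (gradient G y) w + ‖w‖ ^ 2 := by
      rw [← real_inner_self_eq_norm_sq, ← inner_add_left, hw]
      congr 1
      abel
    rw [inner_neg_right, inner_smul_right, norm_neg, norm_smul, mul_pow,
      Real.norm_of_nonneg (inv_nonneg.2 hL0.le), h4] at h1
    have h5 : L / 2 * (L⁻¹ ^ 2 * ‖w‖ ^ 2) = ‖w‖ ^ 2 / (2 * L) := by field_simp
    have h6 : L⁻¹ * ‖w‖ ^ 2 = ‖w‖ ^ 2 / (2 * L) + ‖w‖ ^ 2 / (2 * L) := by field_simp; norm_num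
    linarith
  have h1 := key x y
  have h2 := key y x
  have h3 : inner ℝ (x - y) (gradient G x - gradient G y)
      = - inner ℝ (gradient G y) (x - y) - inner ℝ (gradient G x) (y - x) := by
    rw [← neg_sub x y, inner_neg_right, inner_sub_right, real_inner_comm (gradient G x),
      real_inner_comm (gradient G y)]
    ring
  rw [norm_sub_rev (gradient G y)] at h2
  have h4 : ‖gradient G x - gradient G y‖ ^ 2 / (2 * L) + ‖gradient G x - gradient G y‖ ^ 2 / (2 * L)
      = ‖gradient G x - gradient G y‖ ^ 2 / L := by field_simp; norm_num
  have h5 : ‖gradient G x - gradient G y‖ ^ 2 / L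
      ≤ inner ℝ (x - y) (gradient G x - gradient G y) := by linarith
  refine ⟨le_trans (by positivity) h5, ?_⟩
  rwa [div_le_iff₀' hL0] at h5

end Cocoercivity

/-! ### Extreme eigenvalues and the quadratic form of `K` -/

section Rayleigh

variable {d : ℕ} {K : Matrix (Fin d) (Fin d) ℝ} {κ L_K : ℝ}

lemma hasEigenvalue_toLin'_iff (a : ℝ) :
    Module.End.HasEigenvalue (Matrix.toLin' K) a ↔
      Module.End.HasEigenvalue (Matrix.toEuclideanLin K) a := by
  constructor
  · intro h
    obtain ⟨v, hv⟩ := h.exists_hasEigenvector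
    refine Module.End.hasEigenvalue_of_hasEigenvector (x := WithLp.toLp 2 v)
      ⟨Module.End.mem_eigenspace_iff.2 ?_, ?_⟩
    · have := hv.apply_eq_smul
      rw [Matrix.toLin'_apply] at this
      rw [Matrix.toLpLin_toLp, Matrix.toLin'_apply, this, WithLp.toLp_smul]
    · simpa using hv.2
  · intro h
    obtain ⟨v, hv⟩ := h.exists_hasEigenvector
    refine Module.End.hasEigenvalue_of_hasEigenvector (x := WithLp.ofLp v)
      ⟨Module.End.mem_eigenspace_iff.2 ?_, ?_⟩
    · have := congrArg WithLp.ofLp hv.apply_eq_smul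
      simpa using this
    · simpa using hv.2

lemma symmetric_toEuclideanLin (hK : K.PosDef) : (Matrix.toEuclideanLin K).IsSymmetric :=
  Matrix.isSymmetric_toEuclideanLin_iff.2 hK.isHermitian

/-- Expanding in an orthonormal eigenbasis turns the quadratic form into a sum of squares weighted
by eigenvalues. -/
lemma inner_toEuclideanLin_bounds (hK : K.PosDef)
    (hκ : IsLeast {a : ℝ | Module.End.HasEigenvalue (Matrix.toLin' K) a} κ)
    (hL_K : IsGreatest {a : ℝ | Module.End.HasEigenvalue (Matrix.toLin' K) a} L_K)
    (x : Space d) :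
    κ * ‖x‖ ^ 2 ≤ inner ℝ x (Matrix.toEuclideanLin K x) ∧
      inner ℝ x (Matrix.toEuclideanLin K x) ≤ L_K * ‖x‖ ^ 2 := by
  have hs := symmetric_toEuclideanLin hK
  have hn : Module.finrank ℝ (Space d) = d := by simp
  have hx : inner ℝ x (Matrix.toEuclideanLin K x)
      = ∑ i, hs.eigenvalues hn i * (inner ℝ (hs.eigenvectorBasis hn i) x) ^ 2 := by
    rw [← (hs.eigenvectorBasis hn).sum_inner_mul_inner]
    refine Finset.sum_congr rfl fun i _ ↦ ?_
    rw [← hs, hs.apply_eigenvectorBasis, real_inner_comm]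
    simp [inner_smul_left]
    ring
  have hx2 : ‖x‖ ^ 2 = ∑ i, (inner ℝ (hs.eigenvectorBasis hn i) x) ^ 2 := by
    rw [← real_inner_self_eq_norm_sq, ← (hs.eigenvectorBasis hn).sum_inner_mul_inner]
    refine Finset.sum_congr rfl fun i _ ↦ ?_
    rw [real_inner_comm]
    ring
  have he : ∀ i, hs.eigenvalues hn i ∈ {a : ℝ | Module.End.HasEigenvalue (Matrix.toLin' K) a} :=
    fun i ↦ (hasEigenvalue_toLin'_iff _).2 (hs.hasEigenvalue_eigenvalues hn i)
  rw [hx, hx2, Finset.mul_sum, Finset.mul_sum]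
  exact ⟨Finset.sum_le_sum fun i _ ↦ mul_le_mul_of_nonneg_right (hκ.2 (he i)) (sq_nonneg _),
    Finset.sum_le_sum fun i _ ↦ mul_le_mul_of_nonneg_right (hL_K.2 (he i)) (sq_nonneg _)⟩

lemma leastEigenvalue_pos (hK : K.PosDef)
    (hκ : IsLeast {a : ℝ | Module.End.HasEigenvalue (Matrix.toLin' K) a} κ) : 0 < κ := by
  obtain ⟨v, hv⟩ := Module.End.HasEigenvalue.exists_hasEigenvector hκ.1
  have h := hK.dotProduct_mulVec_pos hv.2
  have h2 := hv.apply_eq_smul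
  rw [Matrix.toLin'_apply] at h2
  rw [h2] at h
  have h3 : 0 ≤ star v ⬝ᵥ v := by
    exact Finset.sum_nonneg fun i _ ↦ mul_self_nonneg (v i)
  rw [dotProduct_smul, smul_eq_mul] at h
  exact pos_of_mul_pos_left h h3

end Rayleigh

end Langevin

noncomputable section

namespace Langevin

/-! ### Infinitesimal contraction and equivalence of norms -/

section Drift

variable {d : ℕ} {V G : Space d → ℝ} {K : Matrix (Fin d) (Fin d) ℝ} {κ L_K L_G u γ : ℝ}

/-- The drift of the Langevin dynamics. -/
def drift (V : Space d → ℝ) (u γ : ℝ) (z : Phase d) : Phase d :=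
  (z.2, -(γ • z.2) - u • gradient V z.1)

/-- The quadratic form whose square root is the twisted distance. -/
def twistedForm (K : Matrix (Fin d) (Fin d) ℝ) (κ u γ : ℝ) (v : Phase d) : ℝ :=
  γ⁻¹ ^ 2 * u * inner ℝ v.1 (Matrix.toEuclideanLin K v.1)
    + 1 / 2 * ‖(1 - 2 * twist κ u γ) • v.1 + γ⁻¹ • v.2‖ ^ 2
    + 1 / 2 * γ⁻¹ ^ 2 * ‖v.2‖ ^ 2

/-- The symmetric bilinear form associated with `twistedForm`. -/
def twistedBilin (K : Matrix (Fin d) (Fin d) ℝ) (κ u γ : ℝ) (v w : Phase d) : ℝ :=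
  γ⁻¹ ^ 2 * u * inner ℝ v.1 (Matrix.toEuclideanLin K w.1)
    + 1 / 2 * inner ℝ ((1 - 2 * twist κ u γ) • v.1 + γ⁻¹ • v.2)
      ((1 - 2 * twist κ u γ) • w.1 + γ⁻¹ • w.2)
    + 1 / 2 * γ⁻¹ ^ 2 * inner ℝ v.2 w.2

lemma twistedDist_eq (z w : Phase d) :
    twistedDist K κ u γ z w = √(twistedForm K κ u γ (z - w)) := rfl

lemma twistedForm_add_smul (hK : K.PosDef) (v w : Phase d) (h : ℝ) :
    twistedForm K κ u γ (v + h • w) = twistedForm K κ u γ v + 2 * h * twistedBilin K κ u γ v w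
      + h ^ 2 * twistedForm K κ u γ w := by
  have hs : inner ℝ w.1 (Matrix.toEuclideanLin K v.1)
      = inner ℝ v.1 (Matrix.toEuclideanLin K w.1) := by
    rw [real_inner_comm]
    exact symmetric_toEuclideanLin hK _ _
  have h1 : (1 - 2 * twist κ u γ) • (v + h • w).1 + γ⁻¹ • (v + h • w).2
      = ((1 - 2 * twist κ u γ) • v.1 + γ⁻¹ • v.2)
        + h • ((1 - 2 * twist κ u γ) • w.1 + γ⁻¹ • w.2) := by
    simp only [Prod.fst_add, Prod.snd_add, Prod.smul_fst, Prod.smul_snd]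
    module
  unfold twistedForm twistedBilin
  rw [h1, norm_add_sq_real _ (h • ((1 - 2 * twist κ u γ) • w.1 + γ⁻¹ • w.2)), Prod.fst_add,
    Prod.snd_add, Prod.smul_fst, Prod.smul_snd, norm_add_sq_real v.2, map_add, map_smul,
    inner_add_left, inner_add_right v.1, inner_add_right (h • w.1),
    norm_smul h, norm_smul h, mul_pow, mul_pow, Real.norm_eq_abs, sq_abs]
  simp only [inner_smul_left, inner_smul_right, hs, RCLike.conj_to_real]
  ring

lemma rate_eq (hγ : 0 < γ) : rate κ u γ = γ * twist κ u γ := by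
  unfold rate twist
  rw [mul_min_of_nonneg _ _ hγ.le]
  congr 1
  · ring
  · field_simp

lemma twist_nonneg (hκ : 0 < κ) (hu : 0 < u) : 0 ≤ twist κ u γ :=
  le_min (by norm_num) (by positivity)

/-- Half the time derivative of the form along the difference of two synchronously coupled
solutions, with `g` standing for the difference of the gradients of `G`. The bound `twist ≤ 1/8`
enters through `1 - 2λ ≥ 3/4`, which matches the threshold in `hL`, and through `1/2 - 2λ ≥ 1/4`. -/
lemma twistedBilin_le (hK : K.PosDef) (hκ : 0 < κ) (hu : 0 < u) (hγ : 0 < γ)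
    (hL : L_G * u * γ⁻¹ ^ 2 ≤ 3 / 4) (z w g : Space d)
    (hz : κ * ‖z‖ ^ 2 ≤ inner ℝ z (Matrix.toEuclideanLin K z))
    (hg0 : 0 ≤ inner ℝ z g) (hg : ‖g‖ ^ 2 ≤ L_G * inner ℝ z g) :
    twistedBilin K κ u γ (z, w) (w, -(γ • w) - u • (Matrix.toEuclideanLin K z + g))
      ≤ -(rate κ u γ * twistedForm K κ u γ (z, w)) := by
  rw [rate_eq hγ]
  have hl0 : 0 ≤ twist κ u γ := twist_nonneg hκ hu
  have hl1 : twist κ u γ ≤ 1 / 8 := min_le_left _ _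
  have hl2 : twist κ u γ ≤ κ * u * γ⁻¹ ^ 2 / 2 := min_le_right _ _
  have hs : inner ℝ w (Matrix.toEuclideanLin K z) = inner ℝ z (Matrix.toEuclideanLin K w) := by
    rw [real_inner_comm]
    exact symmetric_toEuclideanLin hK _ _
  have hsq : 0 ≤ ‖w‖ ^ 2 + 2 * (u * γ⁻¹) * inner ℝ w g + (u * γ⁻¹) ^ 2 * ‖g‖ ^ 2 := by
    have h := norm_add_sq_real w ((u * γ⁻¹) • g)
    rw [inner_smul_right, norm_smul, mul_pow, Real.norm_eq_abs, sq_abs] at h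
    nlinarith [sq_nonneg ‖w + (u * γ⁻¹) • g‖]
  unfold twistedForm twistedBilin
  rw [norm_add_sq_real]
  simp only [inner_add_left, inner_add_right, inner_sub_right, inner_neg_right, inner_smul_left,
    inner_smul_right, norm_smul, mul_pow, Real.norm_eq_abs, sq_abs, RCLike.conj_to_real, hs,
    real_inner_self_eq_norm_sq]
  generalize twist κ u γ = l at *
  have hγq : γ * γ⁻¹ = 1 := mul_inv_cancel₀ hγ.ne'
  have hq0 : 0 < γ⁻¹ := inv_pos.2 hγ
  generalize γ⁻¹ = q at *
  generalize inner ℝ z (Matrix.toEuclideanLin K z) = a at *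
  generalize inner ℝ z (Matrix.toEuclideanLin K w) = b at *
  generalize inner ℝ z w = zw at *
  generalize inner ℝ z g = zg at *
  generalize inner ℝ w g = wg at *
  generalize hgg : ‖g‖ ^ 2 = gg at *
  generalize hww : ‖w‖ ^ 2 = ww at *
  have hzz0 : 0 ≤ ‖z‖ ^ 2 := sq_nonneg _
  generalize ‖z‖ ^ 2 = zz at *
  -- Friction absorbs the cross term `w·g` by completing the square. The cost is a multiple of
  -- `|g|²`, which `e2` and `e2'` charge to `z·g` by cocoercivity.
  have e1 : 0 ≤ q / 2 * ww + u * q ^ 2 * wg + u ^ 2 * q ^ 3 / 2 * gg := by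
    have := mul_nonneg (half_pos hq0).le hsq
    linarith
  have e2 : u ^ 2 * q ^ 3 / 2 * gg ≤ 3 / 8 * (u * q) * zg := by
    have h1 : u ^ 2 * q ^ 3 / 2 * gg ≤ u ^ 2 * q ^ 3 / 2 * (L_G * zg) := by gcongr
    have h2 : u * q / 2 * zg * (L_G * u * q ^ 2) ≤ u * q / 2 * zg * (3 / 4) := by gcongr
    linarith
  have e2' : 3 / 8 * (u * q) * zg ≤ u * q / 2 * (1 - 2 * l) * zg := by
    have : 3 / 8 ≤ (1 - 2 * l) / 2 := by linarith
    have h3 : 3 / 8 * (u * q * zg) ≤ (1 - 2 * l) / 2 * (u * q * zg) := by gcongr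
    linarith
  -- What is left of `z·Kz` after paying for the rate must dominate the `|z|²` term of the form;
  -- `e4` is where `twist ≤ κuγ⁻²/2` is needed.
  have e3 : u * q / 4 * (κ * zz) ≤ (1 / 2 - 2 * l) * (u * q) * a := by
    have h1 : 1 / 4 ≤ 1 / 2 - 2 * l := by linarith
    have h2 : 1 / 4 * (u * q) * (κ * zz) ≤ (1 / 2 - 2 * l) * (u * q) * a := by gcongr
    linarith
  have e4 : γ / 2 * l * (1 - 2 * l) ^ 2 * zz ≤ u * q / 4 * (κ * zz) := by
    have h1 : (1 - 2 * l) ^ 2 ≤ 1 := by nlinarith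
    have h2 : γ / 2 * l * (1 - 2 * l) ^ 2 * zz ≤ γ / 2 * (κ * u * q ^ 2 / 2) * 1 * zz := by gcongr
    calc _ ≤ _ := h2
      _ = (γ * q) * (u * q / 4 * (κ * zz)) := by ring
      _ = _ := by rw [hγq, one_mul]
  linear_combination e1 + e2 + e2' + e3 + e4
    + (l * q * u * a + l * q * ww - q * ww - (1 - 2 * l) ^ 2 / 2 * zw) * hγq

/-- Dropping the twisted square leaves two separate weights. The factor `γ²` cancels against `γ⁻²`
in `twistedForm_upper`, and the remaining product is `M²`. -/
lemma twistedForm_lower (hκ : 0 < κ) (hu : 0 < u) (hγ : 0 < γ) (v : Phase d)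
    (hv : κ * ‖v.1‖ ^ 2 ≤ inner ℝ v.1 (Matrix.toEuclideanLin K v.1)) :
    ‖v.1‖ ^ 2 + ‖v.2‖ ^ 2 ≤ γ ^ 2 * max (1 / (u * κ)) 2 * twistedForm K κ u γ v := by
  have h1 : γ⁻¹ ^ 2 * u * (κ * ‖v.1‖ ^ 2) + 1 / 2 * γ⁻¹ ^ 2 * ‖v.2‖ ^ 2
      ≤ twistedForm K κ u γ v := by
    unfold twistedForm
    have : γ⁻¹ ^ 2 * u * (κ * ‖v.1‖ ^ 2)
      ≤ γ⁻¹ ^ 2 * u * inner ℝ v.1 (Matrix.toEuclideanLin K v.1) := by gcongr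
    have h0 := sq_nonneg ‖(1 - 2 * twist κ u γ) • v.1 + γ⁻¹ • v.2‖
    linarith
  have h2 : γ ^ 2 * max (1 / (u * κ)) 2 *
      (γ⁻¹ ^ 2 * u * (κ * ‖v.1‖ ^ 2) + 1 / 2 * γ⁻¹ ^ 2 * ‖v.2‖ ^ 2)
      = max (1 / (u * κ)) 2 * (u * κ * ‖v.1‖ ^ 2) + max (1 / (u * κ)) 2 * (1 / 2 * ‖v.2‖ ^ 2) := by
    field_simp
  have h3 : 1 / (u * κ) * (u * κ * ‖v.1‖ ^ 2) ≤ max (1 / (u * κ)) 2 * (u * κ * ‖v.1‖ ^ 2) := by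
    gcongr
    exact le_max_left _ _
  have h3' : 1 / (u * κ) * (u * κ * ‖v.1‖ ^ 2) = ‖v.1‖ ^ 2 := by field_simp
  have h4 : 2 * (1 / 2 * ‖v.2‖ ^ 2) ≤ max (1 / (u * κ)) 2 * (1 / 2 * ‖v.2‖ ^ 2) := by
    gcongr
    exact le_max_right _ _
  calc ‖v.1‖ ^ 2 + ‖v.2‖ ^ 2 ≤ γ ^ 2 * max (1 / (u * κ)) 2 *
      (γ⁻¹ ^ 2 * u * (κ * ‖v.1‖ ^ 2) + 1 / 2 * γ⁻¹ ^ 2 * ‖v.2‖ ^ 2) := by linarith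
    _ ≤ _ := by gcongr

lemma twistedForm_upper (hκ : 0 < κ) (hu : 0 < u) (hγ : 0 < γ) (v : Phase d)
    (hv : inner ℝ v.1 (Matrix.toEuclideanLin K v.1) ≤ L_K * ‖v.1‖ ^ 2) :
    twistedForm K κ u γ v
      ≤ γ⁻¹ ^ 2 * max (u * L_K + γ ^ 2) (3 / 2) * (‖v.1‖ ^ 2 + ‖v.2‖ ^ 2) := by
  have hl0 : 0 ≤ twist κ u γ := twist_nonneg hκ hu
  have hl1 : twist κ u γ ≤ 1 / 8 := min_le_left _ _
  -- Halved, this bound gives the `γ²` inside `M`, and together with the velocity term of the form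
  -- the `3/2`.
  have h1 : ‖(1 - 2 * twist κ u γ) • v.1 + γ⁻¹ • v.2‖ ^ 2
      ≤ 2 * ‖v.1‖ ^ 2 + 2 * (γ⁻¹ ^ 2 * ‖v.2‖ ^ 2) := by
    have h := norm_add_le ((1 - 2 * twist κ u γ) • v.1) (γ⁻¹ • v.2)
    rw [norm_smul, norm_smul, Real.norm_of_nonneg (by linarith),
      Real.norm_of_nonneg (inv_nonneg.2 hγ.le)] at h
    have h' : ‖(1 - 2 * twist κ u γ) • v.1 + γ⁻¹ • v.2‖ ≤ ‖v.1‖ + γ⁻¹ * ‖v.2‖ := by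
      nlinarith [norm_nonneg v.1]
    calc _ ≤ (‖v.1‖ + γ⁻¹ * ‖v.2‖) ^ 2 := by gcongr
      _ ≤ _ := by nlinarith [sq_nonneg (‖v.1‖ - γ⁻¹ * ‖v.2‖)]
  have h2 : γ⁻¹ ^ 2 * u * inner ℝ v.1 (Matrix.toEuclideanLin K v.1)
      ≤ γ⁻¹ ^ 2 * u * (L_K * ‖v.1‖ ^ 2) := by gcongr
  have h3 : γ⁻¹ ^ 2 * ((u * L_K + γ ^ 2) * ‖v.1‖ ^ 2)
      ≤ γ⁻¹ ^ 2 * (max (u * L_K + γ ^ 2) (3 / 2) * ‖v.1‖ ^ 2) := by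
    gcongr
    exact le_max_left _ _
  have h4 : γ⁻¹ ^ 2 * ((3 / 2) * ‖v.2‖ ^ 2)
      ≤ γ⁻¹ ^ 2 * (max (u * L_K + γ ^ 2) (3 / 2) * ‖v.2‖ ^ 2) := by
    gcongr
    exact le_max_right _ _
  have h5 : γ⁻¹ ^ 2 * ((u * L_K + γ ^ 2) * ‖v.1‖ ^ 2)
      = γ⁻¹ ^ 2 * u * (L_K * ‖v.1‖ ^ 2) + ‖v.1‖ ^ 2 := by field_simp
  unfold twistedForm
  linarith

/-- This Euclidean bound enters only the second-order error of an Euler step, so a crude constant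
suffices. -/
lemma sq_norm_drift_sub_le {ℓ : ℝ} (hu : 0 < u) (hγ : 0 < γ)
    (hV : ∀ x y, ‖gradient V x - gradient V y‖ ≤ ℓ * ‖x - y‖) (z w : Phase d) :
    ‖(drift V u γ z - drift V u γ w).1‖ ^ 2 + ‖(drift V u γ z - drift V u γ w).2‖ ^ 2
      ≤ (1 + 2 * γ ^ 2 + 2 * (u * ℓ) ^ 2) * (‖(z - w).1‖ ^ 2 + ‖(z - w).2‖ ^ 2) := by
  have h2 : (drift V u γ z - drift V u γ w).2
      = -(γ • (z - w).2) - u • (gradient V z.1 - gradient V w.1) := by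
    simp only [drift, Prod.snd_sub]
    module
  have h3 : ‖(drift V u γ z - drift V u γ w).2‖ ≤ γ * ‖(z - w).2‖ + u * (ℓ * ‖(z - w).1‖) := by
    rw [h2]
    refine (norm_sub_le _ _).trans ?_
    rw [norm_neg, norm_smul, norm_smul, Real.norm_of_nonneg hγ.le, Real.norm_of_nonneg hu.le]
    gcongr
    exact hV _ _
  have h4 : ‖(drift V u γ z - drift V u γ w).2‖ ^ 2
      ≤ (γ * ‖(z - w).2‖ + u * (ℓ * ‖(z - w).1‖)) ^ 2 := by gcongr
  have h5 : (drift V u γ z - drift V u γ w).1 = (z - w).2 := rfl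
  rw [h5]
  have h6 := sq_nonneg (γ * ‖(z - w).2‖ - u * (ℓ * ‖(z - w).1‖))
  have h7 : 0 ≤ (u * ℓ) ^ 2 * ‖(z - w).2‖ ^ 2 := by positivity
  have h8 : 0 ≤ (1 + 2 * γ ^ 2) * ‖(z - w).1‖ ^ 2 := by positivity
  nlinarith

/-- The norm here is the sup norm of the product; the constant serves only the convergence of the
Euler scheme and does not affect the rate. -/
lemma lipschitzWith_drift {ℓ : ℝ} (hℓ : 0 ≤ ℓ) (hu : 0 < u) (hγ : 0 < γ)
    (hV : ∀ x y, ‖gradient V x - gradient V y‖ ≤ ℓ * ‖x - y‖) :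
    LipschitzWith (Real.toNNReal (1 + γ + u * ℓ)) (drift V u γ) := by
  refine LipschitzWith.of_dist_le_mul fun z w ↦ ?_
  rw [Real.coe_toNNReal _ (by positivity), dist_eq_norm, dist_eq_norm]
  have h1 : ‖(z - w).1‖ ≤ ‖z - w‖ := norm_fst_le _
  have h2 : ‖(z - w).2‖ ≤ ‖z - w‖ := norm_snd_le _
  have h0 := norm_nonneg (z - w)
  rw [Prod.norm_def (drift V u γ z - drift V u γ w)]
  refine max_le ?_ ?_
  · change ‖(z - w).2‖ ≤ _
    nlinarith [mul_nonneg hγ.le h0, mul_nonneg (mul_nonneg hu.le hℓ) h0]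
  · have h3 : (drift V u γ z - drift V u γ w).2
        = -(γ • (z - w).2) - u • (gradient V z.1 - gradient V w.1) := by
      simp only [drift, Prod.snd_sub]
      module
    rw [h3]
    refine (norm_sub_le _ _).trans ?_
    rw [norm_neg, norm_smul, norm_smul, Real.norm_of_nonneg hγ.le, Real.norm_of_nonneg hu.le]
    calc γ * ‖(z - w).2‖ + u * ‖gradient V z.1 - gradient V w.1‖
        ≤ γ * ‖z - w‖ + u * (ℓ * ‖z - w‖) := by
          gcongr
          exact (hV _ _).trans (by gcongr; exact h1)
      _ ≤ _ := by nlinarith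

end Drift

/-! ### Gradient of the potential -/

section Potential

variable {d : ℕ} {V G : Space d → ℝ} {K : Matrix (Fin d) (Fin d) ℝ} {L_G : ℝ}

lemma hasGradientAt_quadratic (hK : K.PosDef) (x : Space d) :
    HasGradientAt (fun x : Space d ↦ inner ℝ x (Matrix.toEuclideanLin K x) / 2)
      (Matrix.toEuclideanLin K x) x := by
  rw [hasGradientAt_iff_hasFDerivAt]
  let A : Space d →L[ℝ] Space d := (Matrix.toEuclideanLin K).toContinuousLinearMap
  have h := ((hasFDerivAt_id (𝕜 := ℝ) x).inner ℝ A.hasFDerivAt).mul_const (1 / 2 : ℝ)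
  have h' : HasFDerivAt (fun x : Space d ↦ inner ℝ x (Matrix.toEuclideanLin K x) / 2) _ x :=
    h.congr_of_eventuallyEq (Filter.Eventually.of_forall fun y ↦ by simp [A, div_eq_mul_inv])
  refine h'.congr_fderiv ?_
  ext v
  have hs : inner ℝ x (A v) = inner ℝ (A x) v := (symmetric_toEuclideanLin hK x v).symm
  simp [hs, real_inner_comm (A x) v]
  simp only [A, LinearMap.coe_toContinuousLinearMap']
  rw [real_inner_comm]
  ring

/-- Smoothness is assumed of `V` alone; subtracting the quadratic part passes it to `G`. -/
lemma differentiable_of_decomposition (hK : K.PosDef) (hV : ContDiff ℝ 2 V)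
    (hVG : ∀ x, V x = inner ℝ x (Matrix.toEuclideanLin K x) / 2 + G x) : Differentiable ℝ G := by
  have h : G = fun x ↦ V x - inner ℝ x (Matrix.toEuclideanLin K x) / 2 := by
    funext x
    rw [hVG]
    ring
  rw [h]
  exact (hV.differentiable (by norm_num)).sub fun x ↦ (hasGradientAt_quadratic hK x).differentiableAt

lemma gradient_of_decomposition (hK : K.PosDef) (hG : Differentiable ℝ G)
    (hVG : ∀ x, V x = inner ℝ x (Matrix.toEuclideanLin K x) / 2 + G x) (x : Space d) :
    gradient V x = Matrix.toEuclideanLin K x + gradient G x := by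
  have h : V = fun x ↦ inner ℝ x (Matrix.toEuclideanLin K x) / 2 + G x := funext hVG
  refine HasGradientAt.gradient ?_
  rw [h, hasGradientAt_iff_hasFDerivAt, map_add]
  exact (hasGradientAt_quadratic hK x).hasFDerivAt.add (hG x).hasGradientAt.hasFDerivAt

lemma exists_lipschitz_gradient (hK : K.PosDef) (hG : Differentiable ℝ G)
    (hVG : ∀ x, V x = inner ℝ x (Matrix.toEuclideanLin K x) / 2 + G x)
    (hL : ∀ x y, ‖gradient G x - gradient G y‖ ≤ L_G * ‖x - y‖) :
    ∃ ℓ : ℝ, 0 ≤ ℓ ∧ ∀ x y, ‖gradient V x - gradient V y‖ ≤ ℓ * ‖x - y‖ := by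
  let A : Space d →L[ℝ] Space d := (Matrix.toEuclideanLin K).toContinuousLinearMap
  -- The absolute value is taken because no sign of `L_G` is assumed.
  refine ⟨‖A‖ + |L_G|, by positivity, fun x y ↦ ?_⟩
  rw [gradient_of_decomposition hK hG hVG, gradient_of_decomposition hK hG hVG,
    add_sub_add_comm, ← map_sub, add_mul]
  refine (norm_add_le _ _).trans (add_le_add (A.le_opNorm _) ((hL x y).trans ?_))
  gcongr
  exact le_abs_self _

end Potential

end Langevin

end

noncomputable section

namespace Langevin

/-! ### Pathwise convergence of the Euler scheme -/

section Euler

variable {E : Type*} [NormedAddCommGroup E] [NormedSpace ℝ E]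

/-- The explicit Euler scheme with step `h` for `dz = F(z) dt + dβ`, where `β k` is the value of the
driving path at time `k h`. -/
def euler (F : E → E) (h : ℝ) (β : ℕ → E) (z : E) : ℕ → E
  | 0 => z
  | k + 1 => euler F h β z k + h • F (euler F h β z k) + (β (k + 1) - β k)

/-- Additive noise enters scheme and solution through the same increments and cancels, so the path
`b` needs no regularity of its own. The local error comes only from freezing `Z` over a step,
controlled by its oscillation `ε`; a discrete Gronwall recursion does the rest. -/
lemma norm_sub_euler_le [CompleteSpace E] {F : E → E} {L : ℝ≥0} (hF : LipschitzWith L F)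
    {Z b : ℝ → E} (hZ : Continuous Z) {T h ε : ℝ} (hh : 0 ≤ h)
    (hsol : ∀ t, 0 ≤ t → t ≤ T → Z t = Z 0 + (∫ s in (0 : ℝ)..t, F (Z s)) + b t)
    (hε : ∀ s t, 0 ≤ s → s ≤ t → t ≤ T → t - s ≤ h → ‖Z t - Z s‖ ≤ ε) (k : ℕ) (hk : k * h ≤ T) :
    ‖Z (k * h) - euler F h (fun k ↦ b (k * h)) (Z 0) k‖ ≤ ε * ((1 + h * L) ^ k - 1) := by
  induction k with
  | zero => simp [euler]
  | succ k ih =>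
    have hk1 : (k : ℝ) * h ≤ ((k + 1 : ℕ) : ℝ) * h := by
      push_cast
      linarith
    have hkT : (k : ℝ) * h ≤ T := hk1.trans hk
    specialize ih hkT
    have hk0 : 0 ≤ (k : ℝ) * h := by positivity
    have hlen : ((k + 1 : ℕ) : ℝ) * h - k * h = h := by
      push_cast
      ring
    set e := euler F h (fun k ↦ b (k * h)) (Z 0) k with he
    have hFZ : Continuous fun s ↦ F (Z s) := hF.continuous.comp hZ
    have h1 := hsol _ hk0 hkT
    have h2 := hsol _ (hk0.trans hk1) hk
    have hint : (∫ s in (0 : ℝ)..((k + 1 : ℕ) : ℝ) * h, F (Z s))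
        = (∫ s in (0 : ℝ)..(k * h), F (Z s)) + ∫ s in (k * h)..((k + 1 : ℕ) : ℝ) * h, F (Z s) :=
      (intervalIntegral.integral_add_adjacent_intervals (hFZ.intervalIntegrable _ _)
        (hFZ.intervalIntegrable _ _)).symm
    have hsub : (∫ s in (k * h)..((k + 1 : ℕ) : ℝ) * h, F (Z s)) - h • F e
        = ∫ s in (k * h)..((k + 1 : ℕ) : ℝ) * h, (F (Z s) - F e) := by
      rw [intervalIntegral.integral_sub (hFZ.intervalIntegrable _ _)
        (continuous_const.intervalIntegrable _ _), intervalIntegral.integral_const, hlen]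
    have hbound : ‖∫ s in (k * h)..((k + 1 : ℕ) : ℝ) * h, (F (Z s) - F e)‖
        ≤ L * (ε + ‖Z (k * h) - e‖) * h := by
      have := intervalIntegral.norm_integral_le_of_norm_le_const (a := k * h)
        (b := ((k + 1 : ℕ) : ℝ) * h) (f := fun s ↦ F (Z s) - F e)
        (C := L * (ε + ‖Z (k * h) - e‖)) ?_
      · rwa [hlen, abs_of_nonneg hh] at this
      · intro s hs
        rw [Set.uIoc_of_le hk1] at hs
        refine (hF.norm_sub_le _ _).trans ?_
        gcongr
        calc ‖Z s - e‖ = ‖(Z s - Z (k * h)) + (Z (k * h) - e)‖ := by abel_nf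
          _ ≤ ‖Z s - Z (k * h)‖ + ‖Z (k * h) - e‖ := norm_add_le _ _
          _ ≤ _ := by
            gcongr
            exact hε _ _ hk0 hs.1.le (hs.2.trans hk) (by linarith [hs.2])
    have hstep : Z (((k + 1 : ℕ) : ℝ) * h) - euler F h (fun k ↦ b (k * h)) (Z 0) (k + 1)
        = (Z (k * h) - e) + ∫ s in (k * h)..((k + 1 : ℕ) : ℝ) * h, (F (Z s) - F e) := by
      rw [← hsub, euler, ← he, h1, h2, hint]
      abel
    rw [hstep]
    refine (norm_add_le _ _).trans ?_
    have h3 : ‖Z (k * h) - e‖ * (1 + h * L) ≤ ε * ((1 + h * L) ^ k - 1) * (1 + h * L) := by gcongr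
    calc ‖Z (k * h) - e‖ + ‖∫ s in (k * h)..((k + 1 : ℕ) : ℝ) * h, (F (Z s) - F e)‖
        ≤ ‖Z (k * h) - e‖ + L * (ε + ‖Z (k * h) - e‖) * h := by gcongr
      _ = ‖Z (k * h) - e‖ * (1 + h * L) + ε * (h * L) := by ring
      _ ≤ ε * ((1 + h * L) ^ k - 1) * (1 + h * L) + ε * (h * L) := by gcongr
      _ = _ := by ring

/-- The Euler scheme converges to any given continuous solution. -/
lemma tendsto_euler [CompleteSpace E] {F : E → E} {L : ℝ≥0} (hF : LipschitzWith L F)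
    {Z b : ℝ → E} (hZ : Continuous Z) {T : ℝ} (hT : 0 ≤ T)
    (hsol : ∀ t, 0 ≤ t → t ≤ T → Z t = Z 0 + (∫ s in (0 : ℝ)..t, F (Z s)) + b t) :
    Filter.Tendsto (fun n : ℕ ↦ euler F (T / (n + 1)) (fun k ↦ b (k * (T / (n + 1)))) (Z 0) (n + 1))
      Filter.atTop (nhds (Z T)) := by
  rw [Metric.tendsto_atTop]
  intro η hη
  have hpos := Real.exp_pos (T * L)
  -- The exponential bounds the Gronwall factor `(1 + TL/(n+1))^(n+1)` uniformly in `n`.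
  set ε := η / 2 / Real.exp (T * L) with hεdef
  have hε : 0 < ε := by positivity
  have huc : UniformContinuousOn Z (Set.Icc 0 T) :=
    isCompact_Icc.uniformContinuousOn_of_continuous hZ.continuousOn
  obtain ⟨δ, hδ, hδ'⟩ := Metric.uniformContinuousOn_iff.1 huc ε hε
  obtain ⟨N, hN⟩ := exists_nat_gt (T / δ)
  refine ⟨N, fun n hn ↦ ?_⟩
  have hn0 : (0 : ℝ) < n + 1 := by positivity
  have hnN : (N : ℝ) ≤ n := by exact_mod_cast hn
  have hsmall : T / (n + 1) < δ := by
    rw [div_lt_iff₀ hn0]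
    rw [div_lt_iff₀ hδ] at hN
    nlinarith
  have hmul : ((n + 1 : ℕ) : ℝ) * (T / (n + 1)) = T := by
    push_cast
    field_simp
  have h := norm_sub_euler_le hF hZ (h := T / (n + 1)) (ε := ε) (by positivity) hsol
    (fun s t hs hst ht hts ↦ ?_) (n + 1) hmul.le
  · rw [hmul] at h
    rw [dist_comm, dist_eq_norm]
    refine h.trans_lt ?_
    have h1 : (1 + T / (n + 1) * L) ^ (n + 1) ≤ Real.exp (T * L) := by
      calc (1 + T / (n + 1) * L) ^ (n + 1) ≤ (Real.exp (T / (n + 1) * L)) ^ (n + 1) := by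
            gcongr
            linarith [Real.add_one_le_exp (T / (n + 1) * L)]
        _ = Real.exp (T * L) := by
            rw [← Real.exp_nat_mul, ← mul_assoc, hmul]
    calc ε * ((1 + T / (n + 1) * L) ^ (n + 1) - 1) ≤ ε * Real.exp (T * L) := by
          gcongr
          linarith
      _ = η / 2 := by
          rw [hεdef]
          field_simp
      _ < η := half_lt_self hη
  · rw [← dist_eq_norm]
    refine (hδ' t ⟨hs.trans hst, ht⟩ s ⟨hs, hst.trans ht⟩ ?_).le
    rw [Real.dist_eq, abs_of_nonneg (sub_nonneg.2 hst)]
    exact hts.trans_lt hsmall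

end Euler

/-! ### Contraction of the scheme in the twisted distance -/

section Contraction

variable {d : ℕ} {V G : Space d → ℝ} {K : Matrix (Fin d) (Fin d) ℝ} {κ L_K L_G u γ : ℝ}

lemma twistedForm_nonneg (hK : K.PosDef) (hu : 0 < u) (v : Phase d) :
    0 ≤ twistedForm K κ u γ v := by
  have h : 0 ≤ inner ℝ v.1 (Matrix.toEuclideanLin K v.1) := by
    rw [real_inner_comm]
    exact ((Matrix.isPositive_toEuclideanLin_iff).2 hK.posSemidef).inner_nonneg_left v.1
  unfold twistedForm
  positivity

/-- One step of the Euler scheme contracts the twisted distance, up to an error of second order in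
the step size. -/
lemma exists_euler_step_contraction (hK : K.PosDef) (hκ : 0 < κ) (hu : 0 < u) (hγ : 0 < γ)
    (hL : L_G * u * γ⁻¹ ^ 2 ≤ 3 / 4)
    (hKb : ∀ x : Space d, κ * ‖x‖ ^ 2 ≤ inner ℝ x (Matrix.toEuclideanLin K x) ∧
      inner ℝ x (Matrix.toEuclideanLin K x) ≤ L_K * ‖x‖ ^ 2)
    (hG : Differentiable ℝ G) (hc : ConvexOn ℝ Set.univ G)
    (hG_lip : ∀ x y, ‖gradient G x - gradient G y‖ ≤ L_G * ‖x - y‖)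
    (hVG : ∀ x, V x = inner ℝ x (Matrix.toEuclideanLin K x) / 2 + G x) :
    ∃ C : ℝ, ∀ h : ℝ, 0 ≤ h → ∀ z w η : Phase d,
      twistedDist K κ u γ (z + h • drift V u γ z + η) (w + h • drift V u γ w + η)
        ≤ Real.exp (-(rate κ u γ * h) + C * h ^ 2) * twistedDist K κ u γ z w := by
  obtain ⟨ℓ, hℓ, hV⟩ := exists_lipschitz_gradient hK hG hVG hG_lip
  set a := γ ^ 2 * max (1 / (u * κ)) 2
  set b := γ⁻¹ ^ 2 * max (u * L_K + γ ^ 2) (3 / 2)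
  have hb0 : 0 ≤ b := mul_nonneg (by positivity) (le_max_of_le_right (by norm_num))
  set m := 1 + 2 * γ ^ 2 + 2 * (u * ℓ) ^ 2
  have hm0 : 0 ≤ m := by positivity
  -- The quadratic form grows by at most `h² b m a` times itself through the second-order term; the
  -- half comes from the square root.
  refine ⟨b * (m * a) / 2, fun h hh z w η ↦ ?_⟩
  have hdiff : (z + h • drift V u γ z + η) - (w + h • drift V u γ w + η)
      = (z - w) + h • (drift V u γ z - drift V u γ w) := by module
  rw [twistedDist_eq, twistedDist_eq, hdiff, twistedForm_add_smul hK]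
  set Q := twistedForm K κ u γ (z - w)
  have hQ : 0 ≤ Q := twistedForm_nonneg hK hu _
  have h1 : twistedBilin K κ u γ (z - w) (drift V u γ z - drift V u γ w)
      ≤ -(rate κ u γ * Q) := by
    obtain ⟨hg0, hg⟩ := cocoercive_gradient hG hc hG_lip z.1 w.1
    have h := twistedBilin_le hK hκ hu hγ hL (z.1 - w.1) (z.2 - w.2)
      (gradient G z.1 - gradient G w.1) (hKb _).1 hg0 hg
    have hd : drift V u γ z - drift V u γ w = (z.2 - w.2, -(γ • (z.2 - w.2))
        - u • (Matrix.toEuclideanLin K (z.1 - w.1) + (gradient G z.1 - gradient G w.1))) := by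
      refine Prod.ext rfl ?_
      simp only [drift, Prod.snd_sub, gradient_of_decomposition hK hG hVG, map_sub]
      module
    rw [hd]
    exact h
  have h2 : twistedForm K κ u γ (drift V u γ z - drift V u γ w) ≤ b * (m * a) * Q :=
    calc _ ≤ b * (_ + _) := twistedForm_upper hκ hu hγ _ (hKb _).2
      _ ≤ b * (m * (‖(z - w).1‖ ^ 2 + ‖(z - w).2‖ ^ 2)) := by
        gcongr
        exact sq_norm_drift_sub_le hu hγ hV z w
      _ ≤ b * (m * (a * Q)) := by
        gcongr
        exact twistedForm_lower hκ hu hγ _ (hKb _).1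
      _ = _ := by ring
  have h3 : Q + 2 * h * twistedBilin K κ u γ (z - w) (drift V u γ z - drift V u γ w)
      + h ^ 2 * twistedForm K κ u γ (drift V u γ z - drift V u γ w)
      ≤ Real.exp (-(rate κ u γ * h) + b * (m * a) / 2 * h ^ 2) ^ 2 * Q := by
    have h4 : 2 * h * twistedBilin K κ u γ (z - w) (drift V u γ z - drift V u γ w)
        ≤ 2 * h * -(rate κ u γ * Q) := by gcongr
    have h5 : h ^ 2 * twistedForm K κ u γ (drift V u γ z - drift V u γ w)
        ≤ h ^ 2 * (b * (m * a) * Q) := by gcongr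
    have h6 := Real.add_one_le_exp (2 * (-(rate κ u γ * h) + b * (m * a) / 2 * h ^ 2))
    have h7 := mul_le_mul_of_nonneg_right h6 hQ
    rw [← Real.exp_nat_mul]
    push_cast
    linarith
  calc √_ ≤ √(Real.exp (-(rate κ u γ * h) + b * (m * a) / 2 * h ^ 2) ^ 2 * Q) :=
        Real.sqrt_le_sqrt h3
    _ = _ := by rw [Real.sqrt_mul (by positivity), Real.sqrt_sq (Real.exp_pos _).le]

lemma twistedDist_euler_le {ρ h : ℝ} (hρ : 0 ≤ ρ)
    (hstep : ∀ z w η : Phase d,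
      twistedDist K κ u γ (z + h • drift V u γ z + η) (w + h • drift V u γ w + η)
        ≤ ρ * twistedDist K κ u γ z w) (β : ℕ → Phase d) (z w : Phase d) (k : ℕ) :
    twistedDist K κ u γ (euler (drift V u γ) h β z k) (euler (drift V u γ) h β w k)
      ≤ ρ ^ k * twistedDist K κ u γ z w := by
  induction k with
  | zero => simp [euler]
  | succ k ih =>
    refine (hstep _ _ _).trans ?_
    rw [pow_succ', mul_assoc]
    gcongr

lemma euclDist_le_twistedDist (hκ : 0 < κ) (hu : 0 < u) (hγ : 0 < γ)
    (hKb : ∀ x : Space d, κ * ‖x‖ ^ 2 ≤ inner ℝ x (Matrix.toEuclideanLin K x)) (z w : Phase d) :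
    euclDist z w ≤ γ * √(max (1 / (u * κ)) 2) * twistedDist K κ u γ z w := by
  have h := Real.sqrt_le_sqrt (twistedForm_lower (γ := γ) hκ hu hγ (z - w) (hKb _))
  rwa [Real.sqrt_mul (by positivity), Real.sqrt_mul (by positivity), Real.sqrt_sq hγ.le] at h

lemma twistedDist_le_euclDist (hκ : 0 < κ) (hu : 0 < u) (hγ : 0 < γ)
    (hKb : ∀ x : Space d, inner ℝ x (Matrix.toEuclideanLin K x) ≤ L_K * ‖x‖ ^ 2) (z w : Phase d) :
    twistedDist K κ u γ z w ≤ γ⁻¹ * √(max (u * L_K + γ ^ 2) (3 / 2)) * euclDist z w := by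
  have h := Real.sqrt_le_sqrt (twistedForm_upper (γ := γ) hκ hu hγ (z - w) (hKb _))
  have hmax : 0 ≤ max (u * L_K + γ ^ 2) (3 / 2) := le_max_of_le_right (by norm_num)
  rwa [Real.sqrt_mul (by positivity), Real.sqrt_mul (by positivity),
    Real.sqrt_sq (inv_nonneg.2 hγ.le)] at h

lemma continuous_twistedDist :
    Continuous fun q : Phase d × Phase d ↦ twistedDist K κ u γ q.1 q.2 := by
  have : Continuous (Matrix.toEuclideanLin K) := LinearMap.continuous_of_finiteDimensional _
  unfold twistedDist
  fun_prop

lemma continuous_euclDist : Continuous fun q : Phase d × Phase d ↦ euclDist q.1 q.2 := by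
  unfold euclDist
  fun_prop

end Contraction

end Langevin

end

noncomputable section

namespace Langevin

/-! ### From pathwise contraction to Wasserstein contraction -/

section Coupling

/-- If measurable maps `E n`, driven by a common noise with law `W`, contract `δ` up to the factor
`ρ n` and converge almost everywhere, then the laws of their limits satisfy the corresponding
Wasserstein contraction. -/
lemma wasserstein_le_of_tendsto {S N : Type*} [MeasurableSpace S] [MeasurableSpace N]
    [TopologicalSpace S] {μ ν μ' ν' : Measure S} [IsProbabilityMeasure μ]
    [IsProbabilityMeasure ν] {W : Measure N} [IsProbabilityMeasure W] {E : ℕ → S × N → S}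
    {Φ Ψ : S × N → S} (hΦ : Measurable Φ) (hΨ : Measurable Ψ)
    (hΦlim : ∀ᵐ q ∂μ.prod W, Filter.Tendsto (fun n ↦ E n q) Filter.atTop (nhds (Φ q)))
    (hΨlim : ∀ᵐ q ∂ν.prod W, Filter.Tendsto (fun n ↦ E n q) Filter.atTop (nhds (Ψ q)))
    (hΦmap : (μ.prod W).map Φ = μ') (hΨmap : (ν.prod W).map Ψ = ν')
    {δ : S → S → ℝ} (hδ : Continuous fun q : S × S ↦ δ q.1 q.2)
    (hδm : Measurable fun q : S × S ↦ δ q.1 q.2)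
    {ρ : ℕ → ℝ} {r : ℝ} (hρ : Filter.Tendsto ρ Filter.atTop (nhds r)) (hr : 0 < r)
    (hcontr : ∀ n z w b, δ (E n (z, b)) (E n (w, b)) ≤ ρ n * δ z w) {p : ℝ} (hp : 1 ≤ p) :
    wasserstein p δ μ' ν' ≤ ENNReal.ofReal r * wasserstein p δ μ ν := by
  have hp0 : 0 < p := zero_lt_one.trans_le hp
  -- A nonzero finite factor can be moved inside the infimum over couplings.
  have hr0 : ENNReal.ofReal r ≠ 0 := by simpa using hr
  nth_rw 2 [wasserstein]
  rw [ENNReal.mul_iInf_of_ne hr0 ENNReal.ofReal_ne_top]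
  refine le_iInf fun ω ↦ ?_
  rw [ENNReal.mul_iInf_of_ne hr0 ENNReal.ofReal_ne_top]
  refine le_iInf fun hω ↦ ?_
  obtain ⟨hprob, hfst, hsnd⟩ := hω
  have hm1 : Measurable fun q : (S × S) × N ↦ (q.1.1, q.2) := by fun_prop
  have hm2 : Measurable fun q : (S × S) × N ↦ (q.1.2, q.2) := by fun_prop
  -- Convergence to `Φ` and `Ψ` is known only almost everywhere for `μ ⊗ W` and `ν ⊗ W`. These are
  -- marginals of `ω ⊗ W`, so both hold almost everywhere there.
  have hmap1 : (ω.prod W).map (fun q ↦ (q.1.1, q.2)) = μ.prod W := by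
    have h := Measure.map_prod_map ω W measurable_fst measurable_id
    rw [hfst, Measure.map_id] at h
    exact h.symm
  have hmap2 : (ω.prod W).map (fun q ↦ (q.1.2, q.2)) = ν.prod W := by
    have h := Measure.map_prod_map ω W measurable_snd measurable_id
    rw [hsnd, Measure.map_id] at h
    exact h.symm
  have hmΘ : Measurable fun q : (S × S) × N ↦ (Φ (q.1.1, q.2), Ψ (q.1.2, q.2)) :=
    (hΦ.comp hm1).prodMk (hΨ.comp hm2)
  set Θ := (ω.prod W).map fun q ↦ (Φ (q.1.1, q.2), Ψ (q.1.2, q.2)) with hΘ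
  have hΘmem : Θ ∈ couplings μ' ν' := by
    refine ⟨Measure.isProbabilityMeasure_map hmΘ.aemeasurable, ?_, ?_⟩
    · rw [hΘ, Measure.map_map measurable_fst hmΘ, ← hΦmap, ← hmap1, Measure.map_map hΦ hm1]
      rfl
    · rw [hΘ, Measure.map_map measurable_snd hmΘ, ← hΨmap, ← hmap2, Measure.map_map hΨ hm2]
      rfl
  have hle : ∀ᵐ q ∂ω.prod W, δ (Φ (q.1.1, q.2)) (Ψ (q.1.2, q.2)) ≤ r * δ q.1.1 q.1.2 := by
    rw [← hmap1] at hΦlim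
    rw [← hmap2] at hΨlim
    filter_upwards [ae_of_ae_map hm1.aemeasurable hΦlim, ae_of_ae_map hm2.aemeasurable hΨlim]
      with q h1 h2
    exact le_of_tendsto_of_tendsto' ((hδ.tendsto _).comp (h1.prodMk_nhds h2))
      (hρ.mul_const _) fun n ↦ hcontr n _ _ _
  have hmeas : Measurable fun q : S × S ↦ ENNReal.ofReal (δ q.1 q.2) ^ p :=
    hδm.ennreal_ofReal.pow_const p
  have hint : ∫⁻ z, ENNReal.ofReal (δ z.1 z.2) ^ p ∂Θ
      ≤ ENNReal.ofReal r ^ p * ∫⁻ z, ENNReal.ofReal (δ z.1 z.2) ^ p ∂ω := by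
    calc ∫⁻ z, ENNReal.ofReal (δ z.1 z.2) ^ p ∂Θ
        = ∫⁻ q, ENNReal.ofReal (δ (Φ (q.1.1, q.2)) (Ψ (q.1.2, q.2))) ^ p ∂ω.prod W :=
          lintegral_map hmeas hmΘ
      _ ≤ ∫⁻ q, ENNReal.ofReal r ^ p * ENNReal.ofReal (δ q.1.1 q.1.2) ^ p ∂ω.prod W := by
          refine lintegral_mono_ae (hle.mono fun q hq ↦ ?_)
          rw [← ENNReal.mul_rpow_of_nonneg _ _ hp0.le, ← ENNReal.ofReal_mul hr.le]
          exact ENNReal.rpow_le_rpow (ENNReal.ofReal_le_ofReal hq) hp0.le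
      _ = ENNReal.ofReal r ^ p * ∫⁻ z, ENNReal.ofReal (δ z.1 z.2) ^ p ∂(ω.prod W).map Prod.fst := by
          rw [lintegral_map hmeas measurable_fst]
          exact lintegral_const_mul _ (hmeas.comp measurable_fst)
      _ = _ := by rw [Measure.map_fst_prod, measure_univ, one_smul]
  refine (iInf₂_le Θ hΘmem).trans ?_
  calc _ ≤ (ENNReal.ofReal r ^ p * ∫⁻ z, ENNReal.ofReal (δ z.1 z.2) ^ p ∂ω) ^ (1 / p) :=
        ENNReal.rpow_le_rpow hint (by positivity)
    _ = _ := by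
        rw [ENNReal.mul_rpow_of_nonneg _ _ (by positivity), ← ENNReal.rpow_mul,
          mul_one_div_cancel hp0.ne', ENNReal.rpow_one]

end Coupling

/-! ### Uniqueness of the law of Brownian motion -/

section Brownian

variable {d : ℕ} {Ω Ω' : Type*} [MeasurableSpace Ω] [MeasurableSpace Ω']
  {P : Measure Ω} {P' : Measure Ω'}

lemma isProjectiveLimit_of_isBrownianReal {X : ℝ≥0 → Ω → ℝ} (hX : IsBrownianReal X P)
    (hm : ∀ t, Measurable (X t)) :
    IsProjectiveLimit (P.map fun ω t ↦ X t ω) BrownianReal.projectiveFamily := by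
  intro I
  rw [Measure.map_map (Finset.measurable_restrict I) (measurable_pi_lambda _ hm)]
  exact (hX.hasLaw I).map_eq

/-- All standard Brownian motions have the same law on path space. -/
lemma map_brownianMotion_eq [IsProbabilityMeasure P] [IsProbabilityMeasure P']
    {B : ℝ≥0 → Ω → Space d} {B' : ℝ≥0 → Ω' → Space d}
    (hB : IsBrownianMotion P B) (hB' : IsBrownianMotion P' B') :
    P.map (fun ω t ↦ B t ω) = P'.map (fun ω t ↦ B' t ω) := by
  have hm : ∀ i t, Measurable fun ω ↦ B t ω i := fun i t ↦ by
    have := hB.measurable t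
    fun_prop
  have hm' : ∀ i t, Measurable fun ω ↦ B' t ω i := fun i t ↦ by
    have := hB'.measurable t
    fun_prop
  have h1 := (iIndepFun_iff_map_fun_eq_pi_map
    fun i ↦ (measurable_pi_lambda _ (hm i)).aemeasurable).1 hB.indep
  have h2 := (iIndepFun_iff_map_fun_eq_pi_map
    fun i ↦ (measurable_pi_lambda _ (hm' i)).aemeasurable).1 hB'.indep
  have h3 : ∀ i, P.map (fun ω t ↦ B t ω i) = P'.map (fun ω t ↦ B' t ω i) := fun i ↦
    (isProjectiveLimit_of_isBrownianReal (hB.isBrownianReal i) (hm i)).unique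
      (isProjectiveLimit_of_isBrownianReal (hB'.isBrownianReal i) (hm' i))
  simp_rw [h3, ← h2] at h1
  -- The coordinate paths have equal product laws; `S` reassembles them into one vector-valued path.
  let S : (Fin d → ℝ≥0 → ℝ) → ℝ≥0 → Space d := fun f t ↦ WithLp.toLp 2 fun i ↦ f i t
  have hS : Measurable S := by
    refine measurable_pi_lambda _ fun t ↦ (WithLp.measurable_toLp 2 _).comp ?_
    fun_prop
  have h4 := congrArg (Measure.map S) h1
  rw [Measure.map_map hS (measurable_pi_lambda _ fun i ↦ measurable_pi_lambda _ (hm i)),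
    Measure.map_map hS (measurable_pi_lambda _ fun i ↦ measurable_pi_lambda _ (hm' i))] at h4
  exact h4

end Brownian

/-! ### Solutions as measurable functionals of initial value and noise -/

section Scheme

variable {d : ℕ} {V : Space d → ℝ} {u γ : ℝ}

lemma measurable_euler {E A : Type*} [NormedAddCommGroup E] [NormedSpace ℝ E] [MeasurableSpace E]
    [BorelSpace E] [SecondCountableTopology E] [MeasurableSpace A] {F : E → E} (hF : Measurable F)
    (h : ℝ) {β : ℕ → A → E} (hβ : ∀ k, Measurable (β k)) {z : A → E} (hz : Measurable z) (m : ℕ) :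
    Measurable fun a ↦ euler F h (fun k ↦ β k a) (z a) m := by
  induction m with
  | zero => exact hz
  | succ m ih => exact (ih.add ((hF.comp ih).const_smul h)).add ((hβ (m + 1)).sub (hβ m))

/-- The Euler approximation with `n + 1` steps of the Langevin dynamics at time `T`, as a function
of the initial value and of the Brownian path. -/
def langevinEuler (V : Space d → ℝ) (u γ T : ℝ) (n : ℕ) (q : Phase d × (ℝ≥0 → Space d)) :
    Phase d :=
  euler (drift V u γ) (T / (n + 1))
    (fun k ↦ (0, √(2 * γ * u) • q.2 (k * (T / (n + 1))).toNNReal)) q.1 (n + 1)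

lemma measurable_langevinEuler (hF : Continuous (drift V u γ)) (T : ℝ) (n : ℕ) :
    Measurable (langevinEuler V u γ T n) := by
  have hβ : ∀ k : ℕ, Measurable fun q : Phase d × (ℝ≥0 → Space d) ↦
      ((0, √(2 * γ * u) • q.2 (k * (T / (n + 1))).toNNReal) : Phase d) := fun k ↦ by fun_prop
  exact measurable_euler hF.measurable _ hβ measurable_fst _

variable {Ω : Type*} [MeasurableSpace Ω] {P : Measure Ω} {B X Y : ℝ≥0 → Ω → Space d}

lemma IsSolution.ae_tendsto_langevinEuler (hsol : IsSolution P V u γ B X Y) {L : ℝ≥0}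
    (hF : LipschitzWith L (drift V u γ)) (t : ℝ≥0) :
    ∀ᵐ ω ∂P, Filter.Tendsto
      (fun n ↦ langevinEuler V u γ t n ((X 0 ω, Y 0 ω), fun s ↦ B s ω)) Filter.atTop
      (nhds (X t ω, Y t ω)) := by
  filter_upwards [hsol.continuous_paths, hsol.pos_eq, hsol.vel_eq] with ω ⟨hX, hY⟩ hpos hvel
  let Z : ℝ → Phase d := fun s ↦ (X s.toNNReal ω, Y s.toNNReal ω)
  have hZ : Continuous Z :=
    (hX.comp continuous_real_toNNReal).prodMk (hY.comp continuous_real_toNNReal)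
  have hFZ : Continuous fun s ↦ drift V u γ (Z s) := hF.continuous.comp hZ
  have h := tendsto_euler hF (b := fun s ↦ (0, √(2 * γ * u) • B s.toNNReal ω)) hZ t.2
    (fun s hs _ ↦ ?_)
  · simpa [Z, langevinEuler] using h
  · have hi := hFZ.intervalIntegrable (μ := volume) 0 s
    have h1 : (∫ r in (0 : ℝ)..s, drift V u γ (Z r)).1 = ∫ r in (0 : ℝ)..s, Y r.toNNReal ω :=
      ((ContinuousLinearMap.fst ℝ (Space d) (Space d)).intervalIntegral_comp_comm hi).symm
    have h2 : (∫ r in (0 : ℝ)..s, drift V u γ (Z r)).2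
        = ∫ r in (0 : ℝ)..s, (-(γ • Y r.toNNReal ω) - u • gradient V (X r.toNNReal ω)) :=
      ((ContinuousLinearMap.snd ℝ (Space d) (Space d)).intervalIntegral_comp_comm hi).symm
    have hp := hpos s.toNNReal
    have hv := hvel s.toNNReal
    rw [Real.coe_toNNReal s hs] at hp hv
    refine Prod.ext ?_ ?_
    · simp only [Prod.fst_add, add_zero, h1]
      simpa [Z] using hp
    · simp only [Prod.snd_add, h2]
      simpa [Z] using hv

/-- By independence, the pair of initial value and noise has a product law. Each Euler map reads
finitely many coordinates of the path, hence is measurable for the product σ-algebra, and so is the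
set where the maps converge. Convergence therefore transfers from `Ω` to the product space, and
uniqueness of limits identifies `Φ` with the solution at time `t`. -/
lemma exists_measurable_limit_langevinEuler [IsProbabilityMeasure P]
    (hsol : IsSolution P V u γ B X Y) {L : ℝ≥0} (hF : LipschitzWith L (drift V u γ)) (t : ℝ≥0) :
    ∃ Φ : Phase d × (ℝ≥0 → Space d) → Phase d, Measurable Φ ∧
      (∀ᵐ q ∂(lawAt P X Y 0).prod (P.map fun ω s ↦ B s ω),
        Filter.Tendsto (fun n ↦ langevinEuler V u γ t n q) Filter.atTop (nhds (Φ q))) ∧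
      ((lawAt P X Y 0).prod (P.map fun ω s ↦ B s ω)).map Φ = lawAt P X Y t := by
  have hm0 : Measurable fun ω ↦ (X 0 ω, Y 0 ω) :=
    (hsol.measurable_pos 0).prodMk (hsol.measurable_vel 0)
  have hmB : Measurable fun ω (s : ℝ≥0) ↦ B s ω :=
    measurable_pi_lambda _ hsol.brownian.measurable
  have hlaw : P.map (fun ω ↦ ((X 0 ω, Y 0 ω), fun s ↦ B s ω))
      = (lawAt P X Y 0).prod (P.map fun ω s ↦ B s ω) :=
    hsol.indep_init.map_prod_eq_prod_map_map hm0.aemeasurable hmB.aemeasurable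
  have hmq := hm0.prodMk hmB
  have hE := measurable_langevinEuler hF.continuous t
  have hlim := hsol.ae_tendsto_langevinEuler hF t
  have hex : ∀ᵐ q ∂(lawAt P X Y 0).prod (P.map fun ω s ↦ B s ω), ∃ l,
      Filter.Tendsto (fun n ↦ langevinEuler V u γ t n q) Filter.atTop (nhds l) := by
    rw [← hlaw, ae_map_iff hmq.aemeasurable (measurableSet_exists_tendsto hE)]
    exact hlim.mono fun ω hω ↦ ⟨_, hω⟩
  obtain ⟨Φ, hΦ, hΦlim⟩ := measurable_limit_of_tendsto_metrizable_ae
    (fun n ↦ (hE n).aemeasurable) hex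
  refine ⟨Φ, hΦ, hΦlim, ?_⟩
  rw [← hlaw] at hΦlim ⊢
  rw [Measure.map_map hΦ hmq]
  refine Measure.map_congr ?_
  filter_upwards [hlim, ae_of_ae_map hmq.aemeasurable hΦlim] with ω h1 h2
  exact tendsto_nhds_unique h2 h1

end Scheme

end Langevin

end

/-! ### The contraction theorem and the choice of friction -/

theorem mainTheorem4 {d : ℕ} (V G : EuclideanSpace ℝ (Fin d) → ℝ)
    (K : Matrix (Fin d) (Fin d) ℝ) (κ L_K L_G u : ℝ)
    (hV : ContDiff ℝ 2 V)
    (hK : K.PosDef)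
    (hκ : IsLeast {a : ℝ | Module.End.HasEigenvalue (Matrix.toLin' K) a} κ)
    (hL_K : IsGreatest {a : ℝ | Module.End.HasEigenvalue (Matrix.toLin' K) a} L_K)
    (hG_convex : ConvexOn ℝ Set.univ G)
    (hG_lip : ∀ x y, ‖gradient G x - gradient G y‖ ≤ L_G * ‖x - y‖)
    (hVG : ∀ x, V x = inner ℝ x (Matrix.toEuclideanLin K x) / 2 + G x)
    (hu : 0 < u) :
    (∀ γ : ℝ, 0 < γ → L_G * u * γ⁻¹ ^ 2 ≤ 3 / 4 →
      Langevin.rate κ u γ = γ * Langevin.twist κ u γ ∧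
      ∀ {Ω Ω' : Type*} [MeasurableSpace Ω] [MeasurableSpace Ω']
        (P : Measure Ω) (P' : Measure Ω') [IsProbabilityMeasure P] [IsProbabilityMeasure P']
        (B X Y : ℝ≥0 → Ω → EuclideanSpace ℝ (Fin d))
        (B' X' Y' : ℝ≥0 → Ω' → EuclideanSpace ℝ (Fin d)),
        Langevin.IsSolution P V u γ B X Y → Langevin.IsSolution P' V u γ B' X' Y' →
        ∀ (p : ℝ), 1 ≤ p → ∀ t : ℝ≥0,
          Langevin.wasserstein p (Langevin.twistedDist K κ u γ)
              (Langevin.lawAt P X Y t) (Langevin.lawAt P' X' Y' t)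
            ≤ ENNReal.ofReal (Real.exp (-(Langevin.rate κ u γ * t)))
              * Langevin.wasserstein p (Langevin.twistedDist K κ u γ)
                (Langevin.lawAt P X Y 0) (Langevin.lawAt P' X' Y' 0) ∧
          Langevin.wasserstein p Langevin.euclDist
              (Langevin.lawAt P X Y t) (Langevin.lawAt P' X' Y' t)
            ≤ ENNReal.ofReal (Langevin.equivConst κ L_K u γ
                * Real.exp (-(Langevin.rate κ u γ * t)))
              * Langevin.wasserstein p Langevin.euclDist
                (Langevin.lawAt P X Y 0) (Langevin.lawAt P' X' Y' 0)) ∧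
    (L_G ≤ 3 * κ →
      L_G * u * (2 * √(κ * u))⁻¹ ^ 2 ≤ 3 / 4 ∧
      Langevin.rate κ u (2 * √(κ * u)) = √(κ * u) / 4) := by
  have hκ0 : 0 < κ := Langevin.leastEigenvalue_pos hK hκ
  have hKb := Langevin.inner_toEuclideanLin_bounds hK hκ hL_K
  have hG := Langevin.differentiable_of_decomposition hK hV hVG
  refine ⟨fun γ hγ hL ↦ ⟨Langevin.rate_eq hγ, ?_⟩, fun hL ↦ ⟨?_, ?_⟩⟩
  · intro Ω Ω' _ _ P P' _ _ B X Y B' X' Y' hsol hsol' p hp t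
    obtain ⟨ℓ, hℓ, hVlip⟩ := Langevin.exists_lipschitz_gradient hK hG hVG hG_lip
    have hF := Langevin.lipschitzWith_drift hℓ hu hγ hVlip
    obtain ⟨C, hC⟩ := Langevin.exists_euler_step_contraction hK hκ0 hu hγ hL hKb hG hG_convex
      hG_lip hVG
    obtain ⟨Φ, hΦ, hΦlim, hΦmap⟩ := Langevin.exists_measurable_limit_langevinEuler hsol hF t
    obtain ⟨Ψ, hΨ, hΨlim, hΨmap⟩ := Langevin.exists_measurable_limit_langevinEuler hsol' hF t
    -- Both limits are now driven by the same noise law, as the synchronous coupling requires.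
    rw [← Langevin.map_brownianMotion_eq hsol.brownian hsol'.brownian] at hΨlim hΨmap
    have hprob : IsProbabilityMeasure (Langevin.lawAt P X Y 0) :=
      Measure.isProbabilityMeasure_map
        ((hsol.measurable_pos 0).prodMk (hsol.measurable_vel 0)).aemeasurable
    have hprob' : IsProbabilityMeasure (Langevin.lawAt P' X' Y' 0) :=
      Measure.isProbabilityMeasure_map
        ((hsol'.measurable_pos 0).prodMk (hsol'.measurable_vel 0)).aemeasurable
    have hprobB : IsProbabilityMeasure (P.map fun ω s ↦ B s ω) :=
      Measure.isProbabilityMeasure_map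
        (measurable_pi_lambda _ hsol.brownian.measurable).aemeasurable
    let ρ : ℕ → ℝ := fun n ↦
      Real.exp (-(Langevin.rate κ u γ * (t / (n + 1))) + C * (t / (n + 1)) ^ 2) ^ (n + 1)
    have hρ : Filter.Tendsto ρ Filter.atTop (nhds (Real.exp (-(Langevin.rate κ u γ * t)))) := by
      have hρ' : ρ = fun n : ℕ ↦
          Real.exp (-(Langevin.rate κ u γ * t) + C * t ^ 2 * (1 / ((n : ℝ) + 1))) := by
        funext n
        simp only [ρ]
        rw [← Real.exp_nat_mul]
        congr 1
        push_cast
        field_simp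
      rw [hρ']
      have h := (tendsto_one_div_add_atTop_nhds_zero_nat (𝕜 := ℝ)).const_mul (C * (t : ℝ) ^ 2)
      have h' := (h.const_add (-(Langevin.rate κ u γ * t)))
      rw [mul_zero, add_zero] at h'
      exact (Real.continuous_exp.tendsto _).comp h'
    have hcontr : ∀ n z w b,
        Langevin.twistedDist K κ u γ (Langevin.langevinEuler V u γ t n (z, b))
          (Langevin.langevinEuler V u γ t n (w, b))
          ≤ ρ n * Langevin.twistedDist K κ u γ z w := fun n z w b ↦
      Langevin.twistedDist_euler_le (Real.exp_pos _).le (hC _ (by positivity)) _ _ _ _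
    have hM : Langevin.equivConst κ L_K u γ = γ * √(max (1 / (u * κ)) 2)
        * (γ⁻¹ * √(max (u * L_K + γ ^ 2) (3 / 2))) := by
      rw [Langevin.equivConst, Real.sqrt_mul (le_max_of_le_right (by norm_num))]
      field_simp
    refine ⟨Langevin.wasserstein_le_of_tendsto hΦ hΨ hΦlim hΨlim hΦmap hΨmap
      Langevin.continuous_twistedDist Langevin.continuous_twistedDist.measurable hρ
      (Real.exp_pos _) hcontr hp, ?_⟩
    -- The distances are compared once for the whole scheme, not at each step, so `M` appears only
    -- once.
    refine Langevin.wasserstein_le_of_tendsto hΦ hΨ hΦlim hΨlim hΦmap hΨmap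
      Langevin.continuous_euclDist Langevin.continuous_euclDist.measurable
      (hρ.const_mul (Langevin.equivConst κ L_K u γ)) ?_ (fun n z w b ↦ ?_) hp
    · have : 0 < max (u * L_K + γ ^ 2) (3 / 2) := lt_max_of_lt_right (by norm_num)
      rw [hM]
      positivity
    · have h0 : 0 ≤ ρ n := by positivity
      calc Langevin.euclDist (Langevin.langevinEuler V u γ t n (z, b))
            (Langevin.langevinEuler V u γ t n (w, b))
          ≤ γ * √(max (1 / (u * κ)) 2) * _ :=
            Langevin.euclDist_le_twistedDist hκ0 hu hγ (fun x ↦ (hKb x).1) _ _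
        _ ≤ γ * √(max (1 / (u * κ)) 2) * (ρ n * Langevin.twistedDist K κ u γ z w) := by
            gcongr
            exact hcontr n z w b
        _ ≤ γ * √(max (1 / (u * κ)) 2) * (ρ n *
            (γ⁻¹ * √(max (u * L_K + γ ^ 2) (3 / 2)) * Langevin.euclDist z w)) := by
            gcongr
            exact Langevin.twistedDist_le_euclDist hκ0 hu hγ (fun x ↦ (hKb x).2) _ _
        _ = _ := by
            rw [hM]
            ring
  · have h : (2 * √(κ * u))⁻¹ ^ 2 = 1 / (4 * (κ * u)) := by
      rw [inv_pow, mul_pow, Real.sq_sqrt (by positivity), one_div]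
      norm_num
    rw [h, mul_one_div, div_le_iff₀ (by positivity)]
    nlinarith
  · have h0 : 0 < √(κ * u) := Real.sqrt_pos.2 (by positivity)
    have h : κ * u * (2 * √(κ * u))⁻¹ / 2 = √(κ * u) / 4 := by
      have hs := Real.sq_sqrt (show 0 ≤ κ * u by positivity)
      nth_rw 1 [← hs]
      field_simp
      norm_num
    -- At this friction the two terms of the minimum coincide.
    rw [Langevin.rate, h, min_eq_left (by linarith)]
    ring
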